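/- Let $n\ge 1$ and $k\ge 0$ be integers, and let $S^n$ be the unit sphere in $\mathbb R^{n+1}$ with its standard metric $g$, Levi-Civita connection $\nabla$ and a spin structure. Let $\Sigma$ be the complex spinor bundle of $S^n$, that is, the bundle associated with the spin structure and a complex module of dimension $2^{\lfloor n/2\rfloor}$ over the Clifford algebra of $\mathbb R^n$, with Clifford multiplication $\gamma$ normalized by $$\gamma_a\gamma_b+\gamma_b\gamma_a=-2g_{ab}\,\mathrm{id}_\Sigma .$$ Let $\nabla$ also denote the connection induced on spinor-valued covariant tensors (the spin connection on $\Sigma$, the Levi-Civita connection on tensor indices). Put $\slashed D=\gamma^a\nabla_a$ and $\nabla^*\nabla=-g^{ab}\nabla_a\nabla_b$. Let $\Phi$ be a smooth section of $\Sigma\otimes\Lambda^k$ (a spinor-valued $k$-form) or of $\Sigma\otimes\mathrm{Sym}^k$ (a spinor-valued symmetric $k$-tensor) such that, if $k\ge 1$, $$\gamma^{a_1}\Phi_{a_1a_2\cdots a_k}=0 .$$ Then $$\slashed D^2\Phi_{a_1\cdots a_k}=\Bigl(\nabla^*\nabla+\frac{n(n-1)}{4}+k\Bigr)\Phi_{a_1\cdots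 a_k}.$$ -/

import Mathlib

open scoped Manifold ContDiff

noncomputable section

namespace SphereSpin

/-- Euclidean space of dimension `n + 1`. -/
abbrev Amb (n : ℕ) : Type := EuclideanSpace ℝ (Fin (n + 1))

/-- The unit sphere `S^n`, with Mathlib's smooth structure. -/
abbrev Sph (n : ℕ) : Type := Metric.sphere (0 : Amb n) 1

/-- The differential at `x` of the inclusion of `S^n` into Euclidean space; it identifies
`T_x S^n` with the orthogonal complement of `x`. -/
def incl {n : ℕ} (x : Sph n) (v : TangentSpace (𝓡 n) x) : Amb n :=
  mfderiv (𝓡 n) 𝓘(ℝ, Amb n) (fun y : Sph n => (y : Amb n)) x v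

/-- The standard (round) metric of `S^n`, induced from Euclidean space. -/
def roundMetric {n : ℕ} (x : Sph n) (v w : TangentSpace (𝓡 n) x) : ℝ :=
  inner ℝ (incl x v) (incl x w)

/-- Derivative at `x` of a vector-valued function on `S^n` along a tangent vector. -/
def dirDeriv {n : ℕ} {V : Type*} [NormedAddCommGroup V] [NormedSpace ℝ V]
    (f : Sph n → V) (x : Sph n) (v : TangentSpace (𝓡 n) x) : V :=
  mfderiv (𝓡 n) 𝓘(ℝ, V) f x v

/-- A (local) `n`-frame: `n` vector fields on `S^n`. -/
abbrev Frame (n : ℕ) : Type := Fin n → (x : Sph n) → TangentSpace (𝓡 n) x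

/-- `e` is a smooth orthonormal frame of `T S^n` over `U`. A vector field is smooth when it is
smooth as a map into the ambient Euclidean space. -/
structure IsOrthonormalFrame {n : ℕ} (e : Frame n) (U : Set (Sph n)) : Prop where
  smooth : ∀ a, ContMDiffOn (𝓡 n) 𝓘(ℝ, Amb n) ∞ (fun x => incl x (e a x)) U
  orthonormal : ∀ x ∈ U, ∀ a b, roundMetric x (e a x) (e b x) = if a = b then 1 else 0

/-- `g(∇_{e_a} e_b, e_c)` for the Levi-Civita connection `∇` of the round metric. Here `∇_X Y` is
the tangential part of the Euclidean derivative of `Y` along `X`; as `e_c` is tangential, its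
inner product with `e_c` is that of the Euclidean derivative. -/
def lcCoeff {n : ℕ} (e : Frame n) (a b c : Fin n) (x : Sph n) : ℝ :=
  inner ℝ (dirDeriv (fun y => incl y (e b y)) x (e a x)) (incl x (e c x))

/-- The quadratic form `v ↦ -|v|²` on `ℝⁿ`. -/
def negSq (n : ℕ) : QuadraticForm ℝ (Fin n → ℝ) :=
  QuadraticMap.weightedSumSquares ℝ (fun _ : Fin n => (-1 : ℝ))

/-- The Clifford algebra of `ℝⁿ` with the relation `v * v = -|v|²`. -/
abbrev Cl (n : ℕ) : Type := CliffordAlgebra (negSq n)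

/-- The generator of the Clifford algebra given by the `a`-th standard basis vector. -/
def clGen {n : ℕ} (a : Fin n) : Cl n := CliffordAlgebra.ι (negSq n) (Pi.single a 1)

/-- A spin structure on the round sphere `S^n`, as a cocycle: local oriented orthonormal frames
`e^i` over an open cover `U_i`, and smooth lifts `g_ij : U_i ∩ U_j → Spin(n)` of the
`SO(n)`-valued transition functions `A_ij`, `e^j_b = ∑_a (A_ij)_{ab} e^i_a`, with
`g_ij g_jk = g_ik`. The lift condition is `g_ij v g_ij⁻¹ = A_ij v` for the vectors `v` of `ℝⁿ`. -/
structure SpinStructure (n : ℕ) (I : Type*) where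
  dom : I → Set (Sph n)
  isOpen_dom : ∀ i, IsOpen (dom i)
  cover : ∀ x, ∃ i, x ∈ dom i
  frame : I → Frame n
  isOrthonormalFrame : ∀ i, IsOrthonormalFrame (frame i) (dom i)
  trans : I → I → Sph n → spinGroup (negSq n)
  smooth_trans : ∀ i j, ∀ l : Module.Dual ℝ (Cl n),
    ContMDiffOn (𝓡 n) 𝓘(ℝ, ℝ) ∞ (fun x => l (trans i j x : Cl n)) (dom i ∩ dom j)
  lift_trans : ∀ i j, ∀ x ∈ dom i ∩ dom j, ∀ b,
    (trans i j x : Cl n) * clGen b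
      = (∑ a, roundMetric x (frame i a x) (frame j b x) • clGen a) * (trans i j x : Cl n)
  cocycle : ∀ i j k, ∀ x ∈ dom i ∩ dom j ∩ dom k,
    trans i j x * trans j k x = trans i k x

section Fields

variable {n : ℕ} {S : Type*} [NormedAddCommGroup S] [NormedSpace ℂ S]

/-- A spinor-valued covariant `k`-tensor field in a spin frame: the components
`Φ_{a_1 … a_k}` with values in the spinor module. -/
abbrev LocalField (n : ℕ) (S : Type*) (k : ℕ) : Type _ := Sph n → (Fin k → Fin n) → S

/-- The matrices `γ_a` (equal to `γ^a` in an orthonormal frame), as the action of the Clifford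
algebra on the spinor module. -/
def gam (ρ : Cl n →ₐ[ℝ] Module.End ℂ S) (a : Fin n) : Module.End ℂ S := ρ (clGen a)

/-- The covariant derivative `(∇Φ)_{a b_1 … b_k} = ∇_a Φ_{b_1 … b_k}`, induced by the Levi-Civita
connection on tensor indices and by its lift to the spin frame bundle on spinors. -/
def covDeriv (ρ : Cl n →ₐ[ℝ] Module.End ℂ S) (e : Frame n) {k : ℕ}
    (Φ : LocalField n S k) : LocalField n S (k + 1) := fun x c =>
  let a : Fin n := c 0
  let b : Fin k → Fin n := Fin.tail c
  dirDeriv (fun y => Φ y b) x (e a x)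
    + (1 / 4 : ℝ) • ∑ i, ∑ j, lcCoeff e a i j x • gam ρ i (gam ρ j (Φ x b))
    - ∑ l : Fin k, ∑ d, lcCoeff e a (b l) d x • Φ x (Function.update b l d)

/-- The operator `γ^a ∇_a`. -/
def localDirac (ρ : Cl n →ₐ[ℝ] Module.End ℂ S) (e : Frame n) {k : ℕ}
    (Φ : LocalField n S k) : LocalField n S k := fun x b =>
  ∑ a, gam ρ a (covDeriv ρ e Φ x (Fin.cons a b))

/-- The formal adjoint `∇*` of `∇`: `(∇*Ψ)_{b_1 … b_k} = -∇^a Ψ_{a b_1 … b_k}`. -/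
def covDerivAdj (ρ : Cl n →ₐ[ℝ] Module.End ℂ S) (e : Frame n) {k : ℕ}
    (Ψ : LocalField n S (k + 1)) : LocalField n S k := fun x b =>
  -∑ a, covDeriv ρ e Ψ x (Fin.cons a (Fin.cons a b))

/-- A spinor-valued `k`-tensor field in all the frames of a spin structure. -/
abbrev Field (n : ℕ) (I : Type*) (S : Type*) (k : ℕ) : Type _ := I → LocalField n S k

variable {I : Type*}

/-- `Φ` is a smooth section of `Σ ⊗ (T*S^n)^{⊗k}`, where `Σ` is the bundle associated with the
spin structure and the action of `Spin(n)` on `S`: the components are smooth and change under a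
change of frames by the cocycle of the spin structure. -/
structure IsSmoothSection (σ : SpinStructure n I) (ρ : Cl n →ₐ[ℝ] Module.End ℂ S) {k : ℕ}
    (Φ : Field n I S k) : Prop where
  smooth : ∀ i b, ContMDiffOn (𝓡 n) 𝓘(ℝ, S) ∞ (fun x => Φ i x b) (σ.dom i)
  compat : ∀ i j, ∀ x ∈ σ.dom i ∩ σ.dom j, ∀ a : Fin k → Fin n,
    Φ i x a = ∑ b : Fin k → Fin n,
      (∏ l, roundMetric x (σ.frame i (a l) x) (σ.frame j (b l) x))
        • ρ (σ.trans i j x : Cl n) (Φ j x b)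

/-- `Φ` is spinor-valued and alternating: a section of `Σ ⊗ Λ^k`. -/
def IsForm (σ : SpinStructure n I) {k : ℕ} (Φ : Field n I S k) : Prop :=
  ∀ i, ∀ x ∈ σ.dom i, ∀ (π : Equiv.Perm (Fin k)) (b : Fin k → Fin n),
    Φ i x (b ∘ π) = (Equiv.Perm.sign π : ℤ) • Φ i x b

/-- `Φ` is spinor-valued and symmetric: a section of `Σ ⊗ Sym^k`. -/
def IsSymmetric (σ : SpinStructure n I) {k : ℕ} (Φ : Field n I S k) : Prop :=
  ∀ i, ∀ x ∈ σ.dom i, ∀ (π : Equiv.Perm (Fin k)) (b : Fin k → Fin n),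
    Φ i x (b ∘ π) = Φ i x b

/-- `γ^{a_1} Φ_{a_1 a_2 … a_k} = 0`; there is no condition for `k = 0`. -/
def CliffordAnnihilated (σ : SpinStructure n I) (ρ : Cl n →ₐ[ℝ] Module.End ℂ S) {k : ℕ}
    (Φ : Field n I S k) : Prop :=
  ∀ i, ∀ x ∈ σ.dom i, ∀ (hk : 0 < k) (b : Fin k → Fin n),
    ∑ a, gam ρ a (Φ i x (Function.update b ⟨0, hk⟩ a)) = 0

/-- The Dirac-type operator `γ^a ∇_a` on spinor-valued `k`-tensor fields. -/
def dirac (σ : SpinStructure n I) (ρ : Cl n →ₐ[ℝ] Module.End ℂ S) {k : ℕ}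
    (Φ : Field n I S k) : Field n I S k := fun i => localDirac ρ (σ.frame i) (Φ i)

/-- The connection Laplacian `∇*∇ = -∇^a ∇_a`. -/
def connLaplacian (σ : SpinStructure n I) (ρ : Cl n →ₐ[ℝ] Module.End ℂ S) {k : ℕ}
    (Φ : Field n I S k) : Field n I S k := fun i =>
  covDerivAdj ρ (σ.frame i) (covDeriv ρ (σ.frame i) (Φ i))

end Fields

end SphereSpin

end

/-! This is a Weitzenböck computation in a local orthonormal frame. Clifford multiplication is
parallel, so the squared operator is `∑ γ_a γ_c ∇²_{a,c}`. By the Clifford relations, its symmetric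
part in `a, c` is minus the trace of the Hessian, which is `∇*∇`. The antisymmetric part only sees
the curvature (`dirac_sq_eq`, `IsOrthonormalFrame.localDirac_localDirac`).

On the unit sphere the curvature in the plane `a, c` is the elementary skew matrix `E_ca - E_ac`,
acting on spinors through `¼ ∑ M_ij γ_i γ_j` and on each tensor index by minus the matrix
(`IsOrthonormalFrame.dirDeriv_lcCoeff`, `IsOrthonormalFrame.frameHessian_sub`). Contracted with `γ_a
γ_c`, the spinor part gives the Lichnerowicz term `n(n-1)/4`. Each tensor index gives exactly `1`
once the gamma-trace in that index vanishes (`curvature_term`). The gamma-trace is assumed to vanish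
in the first index only; symmetry or antisymmetry transfers this to all the others
(`sum_gam_update_eq_zero`).

The analysis on the sphere is reduced to Euclidean calculus by extending functions constantly along
rays. -/

noncomputable section

namespace SphereSpin

/-! ### Calculus on the sphere through radial extension -/

section Calculus

variable {n : ℕ} {V W Z : Type*} [NormedAddCommGroup V] [NormedSpace ℝ V]
  [NormedAddCommGroup W] [NormedSpace ℝ W] [NormedAddCommGroup Z] [NormedSpace ℝ Z]

/-- The radial retraction of Euclidean space minus the origin onto the sphere, with an arbitrary
value at the origin. -/
def radialProj (z : Amb n) : Sph n :=
  if h : z = 0 then ⟨EuclideanSpace.single 0 1, by simp⟩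
  else ⟨‖z‖⁻¹ • z, by simp [norm_smul, h]⟩

lemma coe_radialProj {z : Amb n} (h : z ≠ 0) : (radialProj z : Amb n) = ‖z‖⁻¹ • z := by
  simp [radialProj, h]

@[simp] lemma radialProj_coe (x : Sph n) : radialProj (x : Amb n) = x := by
  have h : (x : Amb n) ≠ 0 := ne_zero_of_mem_unit_sphere x
  ext1
  rw [coe_radialProj h]
  simp

lemma contDiffAt_coe_radialProj (x : Sph n) :
    ContDiffAt ℝ ∞ (fun z : Amb n => (radialProj z : Amb n)) x := by
  have h : (x : Amb n) ≠ 0 := ne_zero_of_mem_unit_sphere x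
  have h1 : ContDiffAt ℝ ∞ (fun z : Amb n => ‖z‖⁻¹ • z) (x : Amb n) :=
    ((contDiffAt_norm ℝ h).inv (by simp)).smul contDiffAt_id
  refine h1.congr_of_eventuallyEq ?_
  filter_upwards [isOpen_ne.mem_nhds h] with z hz
  exact coe_radialProj hz

/-- Smoothness into the sphere is tested in the chart at `x`, stereographic projection from the
antipode `-x`, where the map is a composite of smooth Euclidean maps. -/
lemma contMDiffAt_radialProj (x : Sph n) :
    ContMDiffAt 𝓘(ℝ, Amb n) (𝓡 n) ∞ (radialProj (n := n)) (x : Amb n) := by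
  rw [contMDiffAt_iff_target]
  refine ⟨?_, ?_⟩
  · rw [ContinuousAt, tendsto_subtype_rng]
    exact (contDiffAt_coe_radialProj x).continuousAt
  · rw [radialProj_coe]
    have := Fact.mk (@finrank_euclideanSpace_fin ℝ _ (n + 1))
    let U := (OrthonormalBasis.fromOrthogonalSpanSingleton (𝕜 := ℝ) n
      (ne_zero_of_mem_unit_sphere (-x))).repr
    have h1 : ContDiffAt ℝ ∞ (stereoToFun (-(x : Amb n))) (radialProj (x : Amb n) : Amb n) := by
      refine (contDiffOn_stereoToFun (v := -(x : Amb n))).contDiffAt ?_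
      refine IsOpen.mem_nhds ?_ ?_
      · exact isOpen_ne.preimage (innerSL ℝ (-(x : Amb n))).continuous
      -- Stereographic projection from `-x` is smooth where `⟨-x, z⟩ ≠ 1`; at `z = x` the product is
      -- `-1`.
      · simp
        norm_num
    have h2 : ContDiffAt ℝ ∞
        (fun z : Amb n => U (stereoToFun (-(x : Amb n)) (radialProj z : Amb n))) x :=
      U.contDiff.contDiffAt.comp (x : Amb n) (h1.fun_comp (x : Amb n) (contDiffAt_coe_radialProj x))
    exact h2.contMDiffAt

lemma contMDiff_coe (x : Sph n) :
    ContMDiffAt (𝓡 n) 𝓘(ℝ, Amb n) ∞ (fun y : Sph n => (y : Amb n)) x :=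
  have := Fact.mk (@finrank_euclideanSpace_fin ℝ _ (n + 1))
  contMDiff_coe_sphere x

lemma contDiffAt_comp_radialProj {f : Sph n → V} {x : Sph n}
    (hf : ContMDiffAt (𝓡 n) 𝓘(ℝ, V) ∞ f x) :
    ContDiffAt ℝ ∞ (fun z => f (radialProj z)) (x : Amb n) := by
  refine ContMDiffAt.contDiffAt ?_
  refine ContMDiffAt.comp (I' := 𝓡 n) (x : Amb n) (g := f) ?_ (contMDiffAt_radialProj x)
  simpa using hf

lemma differentiableAt_comp_radialProj {f : Sph n → V} {x : Sph n}
    (hf : ContMDiffAt (𝓡 n) 𝓘(ℝ, V) ∞ f x) :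
    DifferentiableAt ℝ (fun z => f (radialProj z)) (x : Amb n) :=
  (contDiffAt_comp_radialProj hf).differentiableAt (by simp)

/-- The chain rule applied to `f`, seen as the restriction of its radial extension to the sphere.
Every rule of calculus below is imported from Euclidean space through this identity. -/
lemma dirDeriv_eq_fderiv {f : Sph n → V} {x : Sph n}
    (hf : ContMDiffAt (𝓡 n) 𝓘(ℝ, V) ∞ f x) (v : TangentSpace (𝓡 n) x) :
    dirDeriv f x v = fderiv ℝ (fun z => f (radialProj z)) (x : Amb n) (incl x v) := by
  have h1 : f = (fun z : Amb n => f (radialProj z)) ∘ (fun y : Sph n => (y : Amb n)) := by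
    ext y; simp
  have h2 := mfderiv_comp (I := 𝓡 n) (I' := 𝓘(ℝ, Amb n)) (I'' := 𝓘(ℝ, V)) x
    (g := fun z : Amb n => f (radialProj z)) (f := fun y : Sph n => (y : Amb n))
    (differentiableAt_comp_radialProj hf).mdifferentiableAt
    ((contMDiff_coe x).mdifferentiableAt (by simp))
  rw [← h1, mfderiv_eq_fderiv] at h2
  unfold dirDeriv incl
  rw [h2]
  rfl

lemma dirDeriv_congr {f g : Sph n → V} {x : Sph n} (h : f =ᶠ[nhds x] g)
    (v : TangentSpace (𝓡 n) x) : dirDeriv f x v = dirDeriv g x v := by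
  unfold dirDeriv
  rw [h.mfderiv_eq]
  rfl

lemma dirDeriv_const (c : V) (x : Sph n) (v : TangentSpace (𝓡 n) x) :
    dirDeriv (fun _ => c) x v = 0 := by
  rw [dirDeriv_eq_fderiv contMDiffAt_const]
  simp

lemma dirDeriv_clm (T : V →L[ℝ] W) {f : Sph n → V} {x : Sph n}
    (hf : ContMDiffAt (𝓡 n) 𝓘(ℝ, V) ∞ f x) (v : TangentSpace (𝓡 n) x) :
    dirDeriv (fun y => T (f y)) x v = T (dirDeriv f x v) := by
  have h : ContMDiffAt (𝓡 n) 𝓘(ℝ, W) ∞ (fun y => T (f y)) x :=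
    T.contMDiff.contMDiffAt.comp x hf
  rw [dirDeriv_eq_fderiv h, dirDeriv_eq_fderiv hf]
  exact congrArg (fun L => L (incl x v))
    (T.hasFDerivAt.comp (x : Amb n) (differentiableAt_comp_radialProj hf).hasFDerivAt).fderiv

lemma dirDeriv_sum {ι : Type*} (s : Finset ι) {f : ι → Sph n → V} {x : Sph n}
    (hf : ∀ i, ContMDiffAt (𝓡 n) 𝓘(ℝ, V) ∞ (f i) x) (v : TangentSpace (𝓡 n) x) :
    dirDeriv (fun y => ∑ i ∈ s, f i y) x v = ∑ i ∈ s, dirDeriv (f i) x v := by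
  rw [dirDeriv_eq_fderiv (contMDiffAt_finsetSum fun i _ => hf i),
    fderiv_fun_sum fun i _ => differentiableAt_comp_radialProj (hf i)]
  simp [dirDeriv_eq_fderiv (hf _)]

lemma dirDeriv_add {f g : Sph n → V} {x : Sph n} (hf : ContMDiffAt (𝓡 n) 𝓘(ℝ, V) ∞ f x)
    (hg : ContMDiffAt (𝓡 n) 𝓘(ℝ, V) ∞ g x) (v : TangentSpace (𝓡 n) x) :
    dirDeriv (fun y => f y + g y) x v = dirDeriv f x v + dirDeriv g x v := by
  have h : ContMDiffAt (𝓡 n) 𝓘(ℝ, V) ∞ (fun y => f y + g y) x := hf.add hg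
  rw [dirDeriv_eq_fderiv h, fderiv_fun_add (differentiableAt_comp_radialProj hf)
    (differentiableAt_comp_radialProj hg), dirDeriv_eq_fderiv hf, dirDeriv_eq_fderiv hg]
  rfl

lemma contMDiffAt_bilin (B : V →L[ℝ] W →L[ℝ] Z) {f : Sph n → V} {g : Sph n → W} {x : Sph n}
    (hf : ContMDiffAt (𝓡 n) 𝓘(ℝ, V) ∞ f x) (hg : ContMDiffAt (𝓡 n) 𝓘(ℝ, W) ∞ g x) :
    ContMDiffAt (𝓡 n) 𝓘(ℝ, Z) ∞ (fun y => B (f y) (g y)) x :=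
  (B.contMDiff.contMDiffAt.comp x hf).clm_apply hg

lemma dirDeriv_bilin (B : V →L[ℝ] W →L[ℝ] Z) {f : Sph n → V} {g : Sph n → W} {x : Sph n}
    (hf : ContMDiffAt (𝓡 n) 𝓘(ℝ, V) ∞ f x) (hg : ContMDiffAt (𝓡 n) 𝓘(ℝ, W) ∞ g x)
    (v : TangentSpace (𝓡 n) x) :
    dirDeriv (fun y => B (f y) (g y)) x v
      = B (dirDeriv f x v) (g x) + B (f x) (dirDeriv g x v) := by
  rw [dirDeriv_eq_fderiv (contMDiffAt_bilin B hf hg), dirDeriv_eq_fderiv hf,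
    dirDeriv_eq_fderiv hg]
  rw [(B.hasFDerivAt_of_bilinear (differentiableAt_comp_radialProj hf).hasFDerivAt
    (differentiableAt_comp_radialProj hg).hasFDerivAt).fderiv]
  simp [add_comm]

lemma dirDeriv_smul {f : Sph n → ℝ} {g : Sph n → V} {x : Sph n}
    (hf : ContMDiffAt (𝓡 n) 𝓘(ℝ, ℝ) ∞ f x) (hg : ContMDiffAt (𝓡 n) 𝓘(ℝ, V) ∞ g x)
    (v : TangentSpace (𝓡 n) x) :
    dirDeriv (fun y => f y • g y) x v = dirDeriv f x v • g x + f x • dirDeriv g x v :=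
  dirDeriv_bilin (ContinuousLinearMap.lsmul ℝ ℝ) hf hg v

lemma dirDeriv_inner {f g : Sph n → Amb n} {x : Sph n}
    (hf : ContMDiffAt (𝓡 n) 𝓘(ℝ, Amb n) ∞ f x) (hg : ContMDiffAt (𝓡 n) 𝓘(ℝ, Amb n) ∞ g x)
    (v : TangentSpace (𝓡 n) x) :
    dirDeriv (fun y => inner ℝ (f y) (g y)) x v
      = inner ℝ (dirDeriv f x v) (g x) + inner ℝ (f x) (dirDeriv g x v) :=
  dirDeriv_bilin (innerSL ℝ) hf hg v

lemma dirDeriv_coe (x : Sph n) (v : TangentSpace (𝓡 n) x) :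
    dirDeriv (fun y : Sph n => (y : Amb n)) x v = incl x v := rfl

lemma inner_incl_coe (x : Sph n) (v : TangentSpace (𝓡 n) x) :
    inner ℝ (incl x v) (x : Amb n) = (0 : ℝ) := by
  have h := dirDeriv_inner (contMDiff_coe x) (contMDiff_coe x) v
  have h1 : (fun y : Sph n => inner ℝ (y : Amb n) (y : Amb n)) = fun _ => (1 : ℝ) := by
    ext y; simp
  rw [h1, dirDeriv_const, dirDeriv_coe, real_inner_comm (incl x v)] at h
  rw [real_inner_comm] at h ⊢
  linarith

/-- Iterated directional derivatives in terms of the radial extension. -/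
lemma dirDeriv_dirDeriv {U : Set (Sph n)} (hU : IsOpen U) {f : Sph n → V}
    {X : (y : Sph n) → TangentSpace (𝓡 n) y}
    (hf : ContMDiffOn (𝓡 n) 𝓘(ℝ, V) ∞ f U)
    (hX : ContMDiffOn (𝓡 n) 𝓘(ℝ, Amb n) ∞ (fun y => incl y (X y)) U) {x : Sph n} (hx : x ∈ U) :
    ContMDiffAt (𝓡 n) 𝓘(ℝ, V) ∞ (fun y => dirDeriv f y (X y)) x ∧
    ∀ v, dirDeriv (fun y => dirDeriv f y (X y)) x v
      = fderiv ℝ (fderiv ℝ (fun z : Amb n => f (radialProj z))) x (incl x v) (incl x (X x))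
        + fderiv ℝ (fun z : Amb n => f (radialProj z)) x
            (dirDeriv (fun y => incl y (X y)) x v) := by
  have hUx := hU.mem_nhds hx
  have hfx := hf.contMDiffAt hUx
  have hXx := hX.contMDiffAt hUx
  set F := fun z : Amb n => f (radialProj z) with hF
  have hdF : ContDiffAt ℝ ∞ (fderiv ℝ F) (x : Amb n) :=
    (contDiffAt_comp_radialProj hfx).fderiv_right (by simp)
  have hdF' : ContMDiffAt (𝓡 n) 𝓘(ℝ, Amb n →L[ℝ] V) ∞
      (fun y : Sph n => fderiv ℝ F (y : Amb n)) x :=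
    ContMDiffAt.comp (I' := 𝓘(ℝ, Amb n)) x (g := fderiv ℝ F) (f := fun y : Sph n => (y : Amb n))
      hdF.contMDiffAt (contMDiff_coe x)
  have heq : (fun y => dirDeriv f y (X y)) =ᶠ[nhds x]
      fun y => fderiv ℝ F (y : Amb n) (incl y (X y)) := by
    filter_upwards [hUx] with y hy
    exact dirDeriv_eq_fderiv (hf.contMDiffAt (hU.mem_nhds hy)) _
  refine ⟨(hdF'.clm_apply hXx).congr_of_eventuallyEq heq, fun v => ?_⟩
  rw [dirDeriv_congr heq]
  have h := dirDeriv_bilin (ContinuousLinearMap.id ℝ (Amb n →L[ℝ] V)) hdF' hXx v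
  simp only [ContinuousLinearMap.id_apply] at h
  rw [h]
  congr 2
  rw [dirDeriv_eq_fderiv hdF']
  -- The radial extension of `y ↦ DF(y)` is `DF ∘ radialProj`, which differs from `DF` off the
  -- sphere. Their tangential derivatives at `x` agree because the differential of the retraction
  -- fixes tangent vectors.
  have h3 : fderiv ℝ (fun z : Amb n => (radialProj z : Amb n)) (x : Amb n) (incl x v)
      = incl x v := by
    rw [← dirDeriv_eq_fderiv (f := fun y : Sph n => (y : Amb n)) (contMDiff_coe x)]
    rfl
  have h4 : HasFDerivAt (fderiv ℝ F) (fderiv ℝ (fderiv ℝ F) x)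
      ((radialProj (x : Amb n) : Sph n) : Amb n) := by
    rw [radialProj_coe]
    exact (hdF.differentiableAt (by simp)).hasFDerivAt
  have h5 := h4.comp (x : Amb n) (f := fun z : Amb n => (radialProj z : Amb n))
    ((contDiffAt_coe_radialProj x).differentiableAt (by simp)).hasFDerivAt
  have h6 := congrArg (fun L => L (incl x v)) h5.fderiv
  simp only [ContinuousLinearMap.comp_apply, h3] at h6
  exact h6

end Calculus

/-! ### Levi-Civita connection and curvature of the round sphere in a frame -/

section FrameGeometry

variable {n : ℕ} {e : Frame n} {U : Set (Sph n)} {x : Sph n}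

lemma IsOrthonormalFrame.contMDiffAt (he : IsOrthonormalFrame e U) (hU : IsOpen U) (hx : x ∈ U)
    (a : Fin n) : ContMDiffAt (𝓡 n) 𝓘(ℝ, Amb n) ∞ (fun y => incl y (e a y)) x :=
  (he.smooth a).contMDiffAt (hU.mem_nhds hx)

/-- The derivative of a function along a vector field of the frame is smooth. -/
lemma IsOrthonormalFrame.contMDiffOn_dirDeriv (he : IsOrthonormalFrame e U) (hU : IsOpen U)
    {V : Type*} [NormedAddCommGroup V] [NormedSpace ℝ V] {f : Sph n → V}
    (hf : ContMDiffOn (𝓡 n) 𝓘(ℝ, V) ∞ f U) (a : Fin n) :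
    ContMDiffOn (𝓡 n) 𝓘(ℝ, V) ∞ (fun y => dirDeriv f y (e a y)) U := fun _ hy =>
  (dirDeriv_dirDeriv hU hf (he.smooth a) hy).1.contMDiffWithinAt

lemma IsOrthonormalFrame.contMDiffOn_lcCoeff (he : IsOrthonormalFrame e U) (hU : IsOpen U)
    (a b c : Fin n) : ContMDiffOn (𝓡 n) 𝓘(ℝ, ℝ) ∞ (lcCoeff e a b c) U := fun _ hy =>
  (contMDiffAt_bilin (innerSL ℝ)
    ((he.contMDiffOn_dirDeriv hU (he.smooth b) a).contMDiffAt (hU.mem_nhds hy))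
    (he.contMDiffAt hU hy c)).contMDiffWithinAt

lemma IsOrthonormalFrame.inner_eq (he : IsOrthonormalFrame e U) (hx : x ∈ U) (a b : Fin n) :
    inner ℝ (incl x (e a x)) (incl x (e b x)) = if a = b then (1 : ℝ) else 0 :=
  he.orthonormal x hx a b

/-- The frame together with the position vector is an orthonormal basis. -/
lemma IsOrthonormalFrame.expand (he : IsOrthonormalFrame e U) (hx : x ∈ U) (w : Amb n) :
    w = (∑ c, (inner ℝ w (incl x (e c x)) : ℝ) • incl x (e c x))
      + (inner ℝ w (x : Amb n) : ℝ) • (x : Amb n) := by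
  have hon : Orthonormal ℝ
      (Fin.cons (x : Amb n) fun c => incl x (e c x) : Fin (n + 1) → Amb n) := by
    rw [orthonormal_iff_ite]
    intro i j
    refine Fin.cases ?_ (fun i => ?_) i <;> refine Fin.cases ?_ (fun j => ?_) j
    · simp
    · rw [Fin.cons_zero, Fin.cons_succ, real_inner_comm, inner_incl_coe,
        if_neg (Fin.succ_ne_zero j).symm]
    · simp [inner_incl_coe, Fin.succ_ne_zero]
    · simp [he.inner_eq hx]
  let B := basisOfOrthonormalOfCardEqFinrank hon (by simp)
  have hB : (B : Fin (n + 1) → Amb n) = Fin.cons (x : Amb n) fun c => incl x (e c x) :=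
    coe_basisOfOrthonormalOfCardEqFinrank hon _
  have h := (B.toOrthonormalBasis (by rw [hB]; exact hon)).sum_repr' w
  simp only [Module.Basis.coe_toOrthonormalBasis, hB, Fin.sum_univ_succ, Fin.cons_zero,
    Fin.cons_succ] at h
  rw [add_comm]
  simpa only [real_inner_comm w] using h.symm

/-- Differentiating `⟨e_b, x⟩ = 0` along `e_a` gives `-⟨e_b, e_a⟩`: this is the second fundamental
form of the unit sphere, the source of its curvature. -/
lemma IsOrthonormalFrame.inner_dirDeriv_coe (he : IsOrthonormalFrame e U) (hU : IsOpen U)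
    (hx : x ∈ U) (a b : Fin n) :
    inner ℝ (dirDeriv (fun y => incl y (e b y)) x (e a x)) (x : Amb n)
      = if a = b then (-1 : ℝ) else 0 := by
  have h := dirDeriv_inner (he.contMDiffAt hU hx b) (contMDiff_coe x) (e a x)
  simp only [inner_incl_coe, dirDeriv_const, dirDeriv_coe, he.inner_eq hx] at h
  have h2 := eq_neg_of_add_eq_zero_left h.symm
  rw [h2]
  by_cases hab : a = b
  · simp [hab]
  · simp [hab, Ne.symm hab]

/-- The Gauss formula for the frame. -/
lemma IsOrthonormalFrame.dirDeriv_frame (he : IsOrthonormalFrame e U) (hU : IsOpen U)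
    (hx : x ∈ U) (a b : Fin n) :
    dirDeriv (fun y => incl y (e b y)) x (e a x)
      = (∑ c, lcCoeff e a b c x • incl x (e c x))
        + (if a = b then (-1 : ℝ) else 0) • (x : Amb n) := by
  rw [← he.inner_dirDeriv_coe hU hx a b]
  exact he.expand hx _

/-- Metric compatibility of the Levi-Civita connection. -/
lemma IsOrthonormalFrame.lcCoeff_antisymm (he : IsOrthonormalFrame e U) (hU : IsOpen U)
    (hx : x ∈ U) (a b c : Fin n) : lcCoeff e a b c x = -lcCoeff e a c b x := by
  have h := dirDeriv_inner (he.contMDiffAt hU hx b) (he.contMDiffAt hU hx c) (e a x)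
  have h1 : (fun y => (inner ℝ (incl y (e b y)) (incl y (e c y)) : ℝ)) =ᶠ[nhds x]
      fun _ => if b = c then (1 : ℝ) else 0 := by
    filter_upwards [hU.mem_nhds hx] with y hy using he.inner_eq hy b c
  rw [dirDeriv_congr h1, dirDeriv_const, real_inner_comm (dirDeriv _ _ _)] at h
  exact eq_neg_of_add_eq_zero_left h.symm

/-- The Levi-Civita connection is torsion free. -/
lemma IsOrthonormalFrame.dirDeriv_commutator (he : IsOrthonormalFrame e U) (hU : IsOpen U)
    (hx : x ∈ U) {V : Type*} [NormedAddCommGroup V] [NormedSpace ℝ V] {f : Sph n → V}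
    (hf : ContMDiffOn (𝓡 n) 𝓘(ℝ, V) ∞ f U) (a b : Fin n) :
    dirDeriv (fun y => dirDeriv f y (e b y)) x (e a x)
        - dirDeriv (fun y => dirDeriv f y (e a y)) x (e b x)
      = ∑ c, (lcCoeff e a b c x - lcCoeff e b a c x) • dirDeriv f x (e c x) := by
  have hfx := hf.contMDiffAt (hU.mem_nhds hx)
  have hsymm : IsSymmSndFDerivAt ℝ (fun z : Amb n => f (radialProj z)) (x : Amb n) :=
    (contDiffAt_comp_radialProj hfx).isSymmSndFDerivAt (by
      rw [minSmoothness_of_isRCLikeNormedField]; exact ENat.LEInfty.out)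
  -- Symmetry of the second derivative leaves `DF` applied to `D_a e_b - D_b e_a`; the radial parts
  -- in the Gauss formula are symmetric in `a, b` and cancel.
  rw [(dirDeriv_dirDeriv hU hf (he.smooth b) hx).2, (dirDeriv_dirDeriv hU hf (he.smooth a) hx).2,
    hsymm.eq, add_sub_add_left_eq_sub, ← map_sub, he.dirDeriv_frame hU hx,
    he.dirDeriv_frame hU hx]
  simp only [eq_comm (a := b) (b := a), add_sub_add_right_eq_sub, ← Finset.sum_sub_distrib,
    ← sub_smul, map_sum, map_smul, dirDeriv_eq_fderiv hfx]

/-- Cartan's second structure equation for the round sphere. -/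
lemma IsOrthonormalFrame.dirDeriv_lcCoeff (he : IsOrthonormalFrame e U) (hU : IsOpen U)
    (hx : x ∈ U) (a b c d : Fin n) :
    dirDeriv (lcCoeff e b c d) x (e a x) - dirDeriv (lcCoeff e a c d) x (e b x)
      = (∑ m, (lcCoeff e a b m x - lcCoeff e b a m x) * lcCoeff e m c d x)
        + (∑ m, (lcCoeff e b c m x * lcCoeff e a d m x - lcCoeff e a c m x * lcCoeff e b d m x))
        + ((if b = c then 1 else 0) * (if a = d then 1 else 0)
          - (if a = c then 1 else 0) * (if b = d then 1 else 0)) := by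
  -- The product rule for `⟨D_b e_c, e_d⟩`. The Gauss formula turns `⟨D_b e_c, D_a e_d⟩` into a
  -- quadratic term in the coefficients plus the product of the two radial components, which yields
  -- the constant curvature term after antisymmetrization in `a, b`.
  have key : ∀ a b : Fin n, dirDeriv (lcCoeff e b c d) x (e a x)
      = inner ℝ (dirDeriv (fun y => dirDeriv (fun y => incl y (e c y)) y (e b y)) x (e a x))
          (incl x (e d x))
        + ((∑ m, lcCoeff e b c m x * lcCoeff e a d m x)
          + (if b = c then 1 else 0) * (if a = d then 1 else 0)) := by
    intro a b
    have h := dirDeriv_inner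
      ((he.contMDiffOn_dirDeriv hU (he.smooth c) b).contMDiffAt (hU.mem_nhds hx))
      (he.contMDiffAt hU hx d) (e a x)
    refine h.trans (congrArg _ ?_)
    rw [he.dirDeriv_frame hU hx b c, he.dirDeriv_frame hU hx a d]
    simp only [inner_add_left, inner_add_right, sum_inner, inner_sum, real_inner_smul_left,
      real_inner_smul_right, he.inner_eq hx, inner_incl_coe, real_inner_comm (incl x _) (x : Amb n)]
    by_cases h1 : b = c <;> by_cases h2 : a = d <;> simp [h1, h2, mul_comm]
  -- Euclidean space is flat: applied to the ambient-valued map `e_c`, the commutator identity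
  -- produces first derivatives only.
  have h := congrArg (fun w => (inner ℝ w (incl x (e d x)) : ℝ))
    (he.dirDeriv_commutator hU hx (he.smooth c) a b)
  simp only [inner_sub_left, sum_inner, real_inner_smul_left] at h
  rw [key a b, key b a, Finset.sum_sub_distrib]
  have h2 : ∑ m, (lcCoeff e a b m x - lcCoeff e b a m x) * lcCoeff e m c d x = _ := h.symm
  rw [h2]
  ring

end FrameGeometry

/-! ### Clifford relations and the spin action of skew matrices -/

section CliffordAlgebraic

variable {n : ℕ} {A : Type*} [Ring A] [Algebra ℝ A]

/-- The elements `γ a` satisfy the Clifford relations of `-|v|²`. -/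
def IsCliffordSystem (γ : Fin n → A) : Prop :=
  ∀ a b, γ a * γ b + γ b * γ a = (if a = b then (-2 : ℝ) else 0) • (1 : A)

/-- The action `¼ ∑ M_ij γ_i γ_j` of a matrix on spinors. -/
def spinAct (γ : Fin n → A) : Matrix (Fin n) (Fin n) ℝ →ₗ[ℝ] A :=
  (1 / 4 : ℝ) • ∑ i, ∑ j, (Matrix.entryLinearMap ℝ ℝ i j).smulRight (γ i * γ j)

lemma spinAct_apply (γ : Fin n → A) (M : Matrix (Fin n) (Fin n) ℝ) :
    spinAct γ M = (1 / 4 : ℝ) • ∑ i, ∑ j, M i j • (γ i * γ j) := by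
  simp [spinAct]

lemma spinAct_single (γ : Fin n → A) (a c : Fin n) :
    spinAct γ (Matrix.single a c 1) = (1 / 4 : ℝ) • (γ a * γ c) := by
  rw [spinAct_apply]
  simp [Matrix.single_apply, ite_and, ite_smul]

lemma IsCliffordSystem.swap {γ : Fin n → A} (h : IsCliffordSystem γ) (a b : Fin n) :
    γ a * γ b = (if a = b then (-2 : ℝ) else 0) • (1 : A) - γ b * γ a :=
  eq_sub_of_add_eq (h a b)

lemma IsCliffordSystem.sq {γ : Fin n → A} (h : IsCliffordSystem γ) (a : Fin n) :
    γ a * γ a = -1 := by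
  have h1 := h a a
  rw [if_pos rfl, ← two_smul ℝ, neg_smul, ← smul_neg] at h1
  exact smul_right_injective A (two_ne_zero (α := ℝ)) h1

/-- For `a ≠ c`, `γ_a γ_c γ_c γ_a = 1` while `(γ_a γ_c)² = -1`. -/
lemma IsCliffordSystem.mul_mul_sub {γ : Fin n → A} (h : IsCliffordSystem γ) (a c : Fin n) :
    γ a * γ c * (γ c * γ a - γ a * γ c) = (if a = c then (0 : ℝ) else 2) • (1 : A) := by
  by_cases hac : a = c
  · simp [hac]
  · have h1 := h.swap c a
    rw [if_neg (Ne.symm hac), zero_smul, zero_sub] at h1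
    have h2 : γ a * γ c * (γ c * γ a) = 1 := by
      rw [mul_assoc, ← mul_assoc (γ c), h.sq]
      simp [h.sq]
    rw [if_neg hac, two_smul, mul_sub, h2, sub_eq_add_neg, ← mul_neg, ← h1, h2]

/-- The scalar curvature term. -/
lemma IsCliffordSystem.sum_spinAct {γ : Fin n → A} (h : IsCliffordSystem γ) :
    (1 / 2 : ℝ) • ∑ a, ∑ c, γ a * γ c * (spinAct γ (Matrix.single c a 1 - Matrix.single a c 1))
      = ((n : ℝ) * ((n : ℝ) - 1) / 4) • (1 : A) := by
  simp only [map_sub, spinAct_single, ← smul_sub, mul_smul_comm, h.mul_mul_sub]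
  simp only [smul_smul, ← Finset.sum_smul]
  congr 1
  simp only [← Finset.mul_sum]
  -- There are `n(n-1)` off-diagonal pairs, each contributing `½ · ¼ · 2`.
  have : ∀ a c : Fin n, (if a = c then (0 : ℝ) else 2) = 2 - if a = c then 2 else 0 := by
    intro a c; split_ifs <;> simp
  simp only [this, Finset.sum_sub_distrib, Finset.sum_const, Finset.sum_ite_eq, Finset.mem_univ,
    if_true, Finset.card_univ, Fintype.card_fin, nsmul_eq_mul]
  ring

/-- The infinitesimal form of the spin covering: the commutator with `γ_c` rotates the vector index.
Through it Clifford multiplication becomes parallel. -/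
lemma IsCliffordSystem.spinAct_mul {γ : Fin n → A} (h : IsCliffordSystem γ)
    {M : Matrix (Fin n) (Fin n) ℝ} (hM : ∀ i j, M i j = -M j i) (c : Fin n) :
    spinAct γ M * γ c = γ c * spinAct γ M + ∑ d, M c d • γ d := by
  have h1 : ∀ i j, γ i * γ j * γ c = γ c * (γ i * γ j)
      + ((if j = c then (-2 : ℝ) else 0) • γ i - (if i = c then (-2 : ℝ) else 0) • γ j) := by
    intro i j
    rw [mul_assoc, h.swap j c, mul_sub, ← mul_assoc (γ i), h.swap i c]
    simp only [mul_smul_comm, sub_mul, smul_mul_assoc, mul_one, one_mul, mul_assoc]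
    abel
  simp only [spinAct_apply, smul_mul_assoc, Finset.sum_mul, mul_smul_comm, Finset.mul_sum, h1,
    smul_add, Finset.sum_add_distrib, smul_sub, Finset.sum_sub_distrib]
  congr 1
  simp only [ite_smul, zero_smul, smul_ite, smul_zero, Finset.sum_ite_eq', Finset.mem_univ,
    if_true]
  rw [Finset.sum_comm]
  simp only [Finset.sum_ite_eq', Finset.mem_univ, if_true, Finset.smul_sum,
    ← Finset.sum_sub_distrib]
  refine Finset.sum_congr rfl fun d _ => ?_
  rw [hM d c]
  module

/-- `spinAct γ M` acts on `γ_i γ_j` as a derivation, so only `M` has to be skew. The bracket is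
reversed because the row index of the matrices is that of the differentiated frame vector, the
transpose of the usual convention. -/
lemma IsCliffordSystem.spinAct_commutator {γ : Fin n → A} (h : IsCliffordSystem γ)
    {M N : Matrix (Fin n) (Fin n) ℝ} (hM : ∀ i j, M i j = -M j i) :
    spinAct γ M * spinAct γ N - spinAct γ N * spinAct γ M = spinAct γ (N * M - M * N) := by
  have h1 : ∀ i j, spinAct γ M * (γ i * γ j) = γ i * γ j * spinAct γ M
      + ((∑ d, M i d • (γ d * γ j)) + ∑ d, M j d • (γ i * γ d)) := by
    intro i j
    rw [← mul_assoc, h.spinAct_mul hM, add_mul, mul_assoc, h.spinAct_mul hM, mul_add, mul_assoc,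
      Finset.sum_mul, Finset.mul_sum]
    simp only [smul_mul_assoc, mul_smul_comm]
    abel
  rw [spinAct_apply γ N, spinAct_apply γ (N * M - M * N)]
  simp only [smul_mul_assoc, Finset.sum_mul, mul_smul_comm, Finset.mul_sum, h1,
    smul_add, Finset.sum_add_distrib, add_sub_cancel_left]
  rw [← smul_add]
  congr 1
  simp only [Matrix.sub_apply, Matrix.mul_apply, sub_smul, Finset.sum_sub_distrib,
    Finset.smul_sum, Finset.sum_smul, smul_smul]
  rw [add_comm, sub_eq_add_neg]
  congr 1
  · exact Finset.sum_congr rfl fun i _ => Finset.sum_comm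
  · rw [← Finset.sum_neg_distrib, Finset.sum_comm]
    rw [Finset.sum_congr rfl fun j _ => Finset.sum_comm, Finset.sum_comm]
    refine Finset.sum_congr rfl fun d _ => ?_
    rw [← Finset.sum_neg_distrib]
    refine Finset.sum_congr rfl fun j _ => ?_
    rw [← Finset.sum_neg_distrib]
    refine Finset.sum_congr rfl fun i _ => ?_
    rw [hM i d]
    module

end CliffordAlgebraic

/-! ### The Ricci and Weitzenböck identities as pointwise algebra -/

section Weitzenbock

variable {n : ℕ} {W : Type*} [AddCommGroup W] [Module ℝ W]

/-- The curvature of the round sphere acts through the action of matrices on the fibre. -/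
lemma hessian_sub_hessian (R : Matrix (Fin n) (Fin n) ℝ →ₗ[ℝ] Module.End ℝ W)
    (g : Fin n → Matrix (Fin n) (Fin n) ℝ) (dg : Fin n → Fin n → Matrix (Fin n) (Fin n) ℝ)
    (hR : ∀ a c, R (g a) * R (g c) - R (g c) * R (g a) = R (g c * g a - g a * g c))
    (u : W) (p : Fin n → W) (q : Fin n → Fin n → W)
    (hq : ∀ a c, q a c - q c a = ∑ d, (g a c d - g c a d) • p d)
    (hdg : ∀ a c, dg a c - dg c a = (∑ m, (g a c m - g c a m) • g m) + (g a * g c - g c * g a)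
      + (Matrix.single c a 1 - Matrix.single a c 1))
    (H : Fin n → Fin n → W)
    (hH : ∀ a c, H a c = q a c + (R (dg a c) u + R (g c) (p a)) + R (g a) (p c + R (g c) u)
      - ∑ d, g a c d • (p d + R (g d) u)) (a c : Fin n) :
    H a c - H c a = R (Matrix.single c a 1 - Matrix.single a c 1) u := by
  have h1 := congrArg (fun T => R T u) (hdg a c)
  have h2 := congrArg (fun T : Module.End ℝ W => T u) (hR a c)
  have h3 := hq a c
  simp only [map_sub, map_add, map_sum, map_smul, LinearMap.sub_apply, LinearMap.add_apply,
    LinearMap.sum_apply, LinearMap.smul_apply, Module.End.mul_apply, sub_smul,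
    Finset.sum_sub_distrib] at h1 h2 h3 ⊢
  rw [hH, hH]
  simp only [smul_add, Finset.sum_add_distrib, map_add]
  linear_combination (norm := module) h1 + h2 + h3

/-- The square of a Dirac type operator as minus the trace of the Hessian and a curvature term. -/
lemma dirac_sq_eq {G : Fin n → Module.End ℝ W} (hG : IsCliffordSystem G)
    (g : Fin n → Matrix (Fin n) (Fin n) ℝ) (hg : ∀ a i j, g a i j = -g a j i)
    (ψ : Fin n → W) (X H : Fin n → Fin n → W)
    (hH : ∀ a c, H a c = X a c - ∑ d, g a c d • ψ d) :
    ∑ a, G a (∑ c, (G c (X a c) + ∑ d, g a c d • G d (ψ c)))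
      = -∑ a, H a a + (1 / 2 : ℝ) • ∑ a, ∑ c, G a (G c (H a c - H c a)) := by
  -- Skewness of the connection matrices moves them from the index of `γ` to that of `ψ`, completing
  -- the iterated derivative `X` to the tensorial Hessian `H`.
  have h1 : ∑ a, G a (∑ c, (G c (X a c) + ∑ d, g a c d • G d (ψ c)))
      = ∑ a, ∑ c, G a (G c (H a c)) := by
    refine Finset.sum_congr rfl fun a _ => ?_
    rw [← map_sum]
    congr 1
    simp only [hH, map_sub, map_sum, map_smul, Finset.sum_add_distrib, Finset.sum_sub_distrib]
    rw [sub_eq_add_neg, ← Finset.sum_neg_distrib, Finset.sum_comm (f := fun c d => g a c d • _)]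
    congr 1
    refine Finset.sum_congr rfl fun d _ => ?_
    rw [← Finset.sum_neg_distrib]
    refine Finset.sum_congr rfl fun c _ => ?_
    rw [hg, neg_smul]
  have h2 : ∑ a, ∑ c, (G a (G c (H a c)) + G c (G a (H a c))) = (-2 : ℝ) • ∑ a, H a a := by
    have h3 : ∀ a c, G a (G c (H a c)) + G c (G a (H a c))
        = (if a = c then (-2 : ℝ) else 0) • H a c := fun a c =>
      congrArg (fun T : Module.End ℝ W => T (H a c)) (hG a c)
    simp only [h3, ite_smul, zero_smul, Finset.sum_ite_eq, Finset.mem_univ, if_true,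
      Finset.smul_sum]
  have h4 : ∑ a, ∑ c, G c (G a (H a c)) = ∑ a, ∑ c, G a (G c (H c a)) := Finset.sum_comm
  simp only [Finset.sum_add_distrib, h4] at h2
  simp only [h1, map_sub, Finset.sum_sub_distrib]
  linear_combination (norm := module) (1 / 2 : ℝ) • h2

end Weitzenbock

/-! ### Skew matrices acting on spinor-valued tensors, and the curvature term -/

section Fibre

variable {n : ℕ} {S : Type*} [NormedAddCommGroup S] [NormedSpace ℂ S]

lemma negSq_polar (a b : Fin n) :
    QuadraticMap.polar (negSq n) (Pi.single a 1) (Pi.single b 1) = if a = b then -2 else 0 := by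
  simp only [QuadraticMap.polar, negSq, QuadraticMap.weightedSumSquares_apply, Pi.add_apply,
    ← Finset.sum_sub_distrib]
  have h : ∀ i, (-1 : ℝ) • (((Pi.single a 1 : Fin n → ℝ) i + (Pi.single b 1 : Fin n → ℝ) i)
        * ((Pi.single a 1 : Fin n → ℝ) i + (Pi.single b 1 : Fin n → ℝ) i))
      - (-1 : ℝ) • ((Pi.single a 1 : Fin n → ℝ) i * (Pi.single a 1 : Fin n → ℝ) i)
      - (-1 : ℝ) • ((Pi.single b 1 : Fin n → ℝ) i * (Pi.single b 1 : Fin n → ℝ) i)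
      = if a = i then (if a = b then -2 else 0) else 0 := by
    intro i
    by_cases h1 : a = i
    · subst h1
      by_cases h2 : a = b
      · subst h2; simp; norm_num
      · simp [h2]
    · simp [Ne.symm h1, h1, Pi.single_apply]
  simp only [h, Finset.sum_ite_eq, Finset.mem_univ, if_true]

lemma isCliffordSystem_clGen : IsCliffordSystem (clGen (n := n)) := by
  intro a b
  rw [clGen, clGen, CliffordAlgebra.ι_mul_ι_add_swap, negSq_polar, Algebra.algebraMap_eq_smul_one]

lemma isCliffordSystem_gam (ρ : Cl n →ₐ[ℝ] Module.End ℂ S) : IsCliffordSystem (gam ρ) := by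
  intro a b
  have h := congrArg ρ (isCliffordSystem_clGen a b)
  rw [map_add, map_mul, map_mul, map_smul, map_one] at h
  exact h

/-- The fibre of the bundle of spinor-valued covariant `k`-tensors in a spin frame. -/
abbrev Fibre (n : ℕ) (S : Type*) (k : ℕ) : Type _ := (Fin k → Fin n) → S

/-- Clifford multiplication on the spinor factor of spinor-valued tensors. -/
def gamOp (ρ : Cl n →ₐ[ℝ] Module.End ℂ S) (k : ℕ) (a : Fin n) :
    Module.End ℝ (Fibre n S k) where
  toFun φ b := gam ρ a (φ b)
  map_add' φ ψ := by ext b; simp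
  map_smul' r φ := by ext b; simp

@[simp] lemma gamOp_apply (ρ : Cl n →ₐ[ℝ] Module.End ℂ S) {k : ℕ} (a : Fin n)
    (φ : Fibre n S k) (b : Fin k → Fin n) : gamOp ρ k a φ b = gam ρ a (φ b) := rfl

lemma isCliffordSystem_gamOp (ρ : Cl n →ₐ[ℝ] Module.End ℂ S) (k : ℕ) :
    IsCliffordSystem (gamOp ρ k) := by
  intro a b
  refine LinearMap.ext fun φ => funext fun c => ?_
  exact congrArg (fun T : Module.End ℂ S => T (φ c)) (isCliffordSystem_gam ρ a b)

/-- The action of a matrix on the tensor index in position `l`. -/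
def slotAct {k : ℕ} (l : Fin k) :
    Matrix (Fin n) (Fin n) ℝ →ₗ[ℝ] Module.End ℝ (Fibre n S k) :=
  LinearMap.mk₂ ℝ (fun M φ b => ∑ d, M (b l) d • φ (Function.update b l d))
    (fun _ _ _ => by ext; simp [add_smul, Finset.sum_add_distrib])
    (fun _ _ _ => by ext; simp [mul_smul, Finset.smul_sum])
    (fun _ _ _ => by ext; simp [Finset.sum_add_distrib])
    (fun r _ _ => by ext; simp [Finset.smul_sum, smul_comm r])

lemma slotAct_apply {k : ℕ} (l : Fin k) (M : Matrix (Fin n) (Fin n) ℝ) (φ : Fibre n S k)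
    (b : Fin k → Fin n) :
    slotAct l M φ b = ∑ d, M (b l) d • φ (Function.update b l d) := rfl

lemma slotAct_mul {k : ℕ} (l : Fin k) (M N : Matrix (Fin n) (Fin n) ℝ) :
    (slotAct l M * slotAct l N : Module.End ℝ (Fibre n S k)) = slotAct l (M * N) := by
  refine LinearMap.ext fun φ => funext fun b => ?_
  simp only [Module.End.mul_apply, slotAct_apply, Function.update_self, Function.update_idem,
    Matrix.mul_apply, Finset.sum_smul, Finset.smul_sum, smul_smul]
  exact Finset.sum_comm

lemma slotAct_comm {k : ℕ} {l m : Fin k} (h : l ≠ m) (M N : Matrix (Fin n) (Fin n) ℝ) :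
    (slotAct l M * slotAct m N : Module.End ℝ (Fibre n S k)) = slotAct m N * slotAct l M := by
  refine LinearMap.ext fun φ => funext fun b => ?_
  simp only [Module.End.mul_apply, slotAct_apply, Function.update_of_ne h,
    Function.update_of_ne h.symm, Finset.smul_sum, smul_smul]
  rw [Finset.sum_comm]
  refine Finset.sum_congr rfl fun d _ => Finset.sum_congr rfl fun d' _ => ?_
  rw [Function.update_comm h, mul_comm]

lemma slotAct_gamOp (ρ : Cl n →ₐ[ℝ] Module.End ℂ S) {k : ℕ} (l : Fin k)
    (M : Matrix (Fin n) (Fin n) ℝ) (a : Fin n) :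
    Commute (slotAct l M) (gamOp ρ k a) := by
  refine LinearMap.ext fun φ => funext fun b => ?_
  simp [slotAct_apply]

/-- The action of a skew matrix on spinor-valued covariant `k`-tensors. -/
def fibreAct (ρ : Cl n →ₐ[ℝ] Module.End ℂ S) (k : ℕ) :
    Matrix (Fin n) (Fin n) ℝ →ₗ[ℝ] Module.End ℝ (Fibre n S k) :=
  spinAct (gamOp ρ k) - ∑ l, slotAct l

lemma fibreAct_apply (ρ : Cl n →ₐ[ℝ] Module.End ℂ S) (k : ℕ) (M : Matrix (Fin n) (Fin n) ℝ) :
    fibreAct ρ k M = spinAct (gamOp ρ k) M - ∑ l, slotAct l M := by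
  simp [fibreAct]

lemma fibreAct_apply_apply (ρ : Cl n →ₐ[ℝ] Module.End ℂ S) {k : ℕ}
    (M : Matrix (Fin n) (Fin n) ℝ) (φ : Fibre n S k) (b : Fin k → Fin n) :
    fibreAct ρ k M φ b = (1 / 4 : ℝ) • (∑ i, ∑ j, M i j • gam ρ i (gam ρ j (φ b)))
      - ∑ l, ∑ d, M (b l) d • φ (Function.update b l d) := by
  simp [fibreAct_apply, spinAct_apply, slotAct_apply, Finset.sum_apply]

lemma fibreAct_mul_gamOp (ρ : Cl n →ₐ[ℝ] Module.End ℂ S) {k : ℕ}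
    {M : Matrix (Fin n) (Fin n) ℝ} (hM : ∀ i j, M i j = -M j i) (c : Fin n) :
    fibreAct ρ k M * gamOp ρ k c = gamOp ρ k c * fibreAct ρ k M + ∑ d, M c d • gamOp ρ k d := by
  rw [fibreAct_apply, sub_mul, (isCliffordSystem_gamOp ρ k).spinAct_mul hM, mul_sub,
    (Commute.sum_left _ _ _ fun l _ => slotAct_gamOp ρ l M c).eq]
  abel

/-- The spin action and the actions on distinct slots commute, so only the bracket within each
factor survives. The minus sign before the slot actions reverses their bracket, matching the spin
action. -/
lemma fibreAct_commutator (ρ : Cl n →ₐ[ℝ] Module.End ℂ S) {k : ℕ}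
    {M N : Matrix (Fin n) (Fin n) ℝ} (hM : ∀ i j, M i j = -M j i) :
    fibreAct ρ k M * fibreAct ρ k N - fibreAct ρ k N * fibreAct ρ k M
      = fibreAct ρ k (N * M - M * N) := by
  have hs : ∀ (P Q : Matrix (Fin n) (Fin n) ℝ),
      Commute (∑ l, slotAct l P) (spinAct (gamOp ρ k) Q) := by
    intro P Q
    refine Commute.sum_left _ _ _ fun l _ => ?_
    rw [spinAct_apply]
    refine Commute.smul_right ?_ _
    refine Commute.sum_right _ _ _ fun i _ => Commute.sum_right _ _ _ fun j _ => ?_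
    exact ((slotAct_gamOp ρ l P i).mul_right (slotAct_gamOp ρ l P j)).smul_right _
  have ht : (∑ l, slotAct l M) * (∑ l, slotAct l N) - (∑ l, slotAct l N) * (∑ l, slotAct l M)
      = -(∑ l, slotAct l (N * M - M * N) : Module.End ℝ (Fibre n S k)) := by
    rw [Finset.sum_mul_sum, Finset.sum_mul_sum,
      Finset.sum_comm (f := fun i j => slotAct i N * slotAct j M), ← Finset.sum_sub_distrib,
      ← Finset.sum_neg_distrib]
    refine Finset.sum_congr rfl fun l _ => ?_
    rw [← Finset.sum_sub_distrib, Finset.sum_eq_single l]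
    · rw [slotAct_mul, slotAct_mul, map_sub, neg_sub]
    · intro m _ hm
      rw [slotAct_comm hm.symm, sub_self]
    · simp
  have h1 := (isCliffordSystem_gamOp ρ k).spinAct_commutator (N := N) hM
  have h2 := (hs M N).eq
  have h3 := (hs N M).eq
  simp only [fibreAct_apply, ← h1, sub_mul, mul_sub, h2, h3]
  rw [sub_eq_iff_eq_add] at ht
  rw [ht]
  abel

/-- The curvature term of the square of the Dirac operator. -/
lemma curvature_term (ρ : Cl n →ₐ[ℝ] Module.End ℂ S) {k : ℕ} (u : Fibre n S k)
    (hu : ∀ (l : Fin k) (b : Fin k → Fin n), ∑ a, gam ρ a (u (Function.update b l a)) = 0) :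
    (1 / 2 : ℝ) • ∑ a, ∑ c, gamOp ρ k a (gamOp ρ k c
        (fibreAct ρ k (Matrix.single c a 1 - Matrix.single a c 1) u))
      = ((n : ℝ) * ((n : ℝ) - 1) / 4 + k) • u := by
  have h1 := congrArg (fun T : Module.End ℝ (Fibre n S k) => T u)
    (isCliffordSystem_gamOp ρ k).sum_spinAct
  simp only [LinearMap.smul_apply, LinearMap.sum_apply, Module.End.mul_apply,
    Module.End.one_apply] at h1
  have h2 : (1 / 2 : ℝ) • ∑ a, ∑ c, gamOp ρ k a (gamOp ρ k c
      ((∑ l, slotAct l (Matrix.single c a 1 - Matrix.single a c 1)) u)) = -((k : ℝ) • u) := by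
    ext b
    -- One Kronecker delta gives `γ_{b_l}` times the gamma-trace, which is zero. In the other,
    -- moving `γ_a` past `γ_{b_l}` gives `-2 u b` minus the same zero. With the factor `½` and the
    -- sign in `fibreAct`, each slot adds `+1`.
    have h3 : ∀ l : Fin k, ∑ a, ∑ c, gam ρ a (gam ρ c
        (slotAct l (Matrix.single c a 1 - Matrix.single a c 1) u b)) = (-2 : ℝ) • u b := by
      intro l
      have h4 : ∀ a c, slotAct l (Matrix.single c a 1 - Matrix.single a c 1) u b
          = (if c = b l then u (Function.update b l a) else 0)
            - (if a = b l then u (Function.update b l c) else 0) := by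
        intro a c
        simp [slotAct_apply, Matrix.single_apply, ite_and, ite_smul]
      have h5 : ∀ a, gam ρ a (gam ρ (b l) (u (Function.update b l a)))
          = (if a = b l then (-2 : ℝ) else 0) • u (Function.update b l a)
            - gam ρ (b l) (gam ρ a (u (Function.update b l a))) := fun a =>
        congrArg (fun T : Module.End ℂ S => T (u (Function.update b l a)))
          ((isCliffordSystem_gam ρ).swap a (b l))
      have h7 : ∀ a c, gam ρ a (gam ρ c
          (slotAct l (Matrix.single c a 1 - Matrix.single a c 1) u b))
          = (if c = b l then gam ρ a (gam ρ (b l) (u (Function.update b l a))) else 0)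
            - (if a = b l then gam ρ (b l) (gam ρ c (u (Function.update b l c))) else 0) := by
        intro a c
        rw [h4, map_sub, map_sub]
        by_cases h8 : c = b l <;> by_cases h9 : a = b l <;> simp [h8, h9]
      simp only [h7, Finset.sum_sub_distrib]
      rw [Finset.sum_comm (f := fun a c => if a = b l then _ else 0)]
      simp only [Finset.sum_ite_eq', Finset.mem_univ, if_true, h5, Finset.sum_sub_distrib,
        ← map_sum, hu, map_zero, sub_zero, ite_smul, zero_smul, Function.update_eq_self]
    have h6 : ∑ a, ∑ c, ∑ l, gam ρ a (gam ρ c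
        (slotAct l (Matrix.single c a 1 - Matrix.single a c 1) u b))
        = ∑ l, ∑ a, ∑ c, gam ρ a (gam ρ c
        (slotAct l (Matrix.single c a 1 - Matrix.single a c 1) u b)) := by
      simp only [Finset.sum_comm (s := (Finset.univ : Finset (Fin n)))
        (t := (Finset.univ : Finset (Fin k)))]
    simp only [Pi.smul_apply, Finset.sum_apply, gamOp_apply, LinearMap.sum_apply, map_sum, h6, h3,
      Pi.neg_apply, Finset.sum_const, Finset.card_univ, Fintype.card_fin]
    rw [← Nat.cast_smul_eq_nsmul ℝ, smul_smul, smul_smul]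
    module
  have h3 : ∀ a (φ ψ : Fibre n S k), gamOp ρ k a (φ - ψ) = gamOp ρ k a φ - gamOp ρ k a ψ :=
    fun a φ ψ => map_sub _ φ ψ
  simp only [fibreAct_apply, LinearMap.sub_apply, h3, Finset.sum_sub_distrib]
  rw [smul_sub, h2, h1]
  module

/-- A transposition carries slot `l` to the first slot. The factor `ε` is irrelevant to vanishing,
so forms and symmetric tensors are treated together. -/
lemma sum_gam_update_eq_zero (ρ : Cl n →ₐ[ℝ] Module.End ℂ S) {k : ℕ} {u : Fibre n S k}
    (hu : ∀ π : Equiv.Perm (Fin k), ∃ ε : ℤ, ∀ b, u (b ∘ π) = ε • u b)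
    (h0 : ∀ (hk : 0 < k) (b : Fin k → Fin n),
      ∑ a, gam ρ a (u (Function.update b ⟨0, hk⟩ a)) = 0) (l : Fin k) (b : Fin k → Fin n) :
    ∑ a, gam ρ a (u (Function.update b l a)) = 0 := by
  have hk : 0 < k := l.pos
  obtain ⟨ε, hε⟩ := hu (Equiv.swap ⟨0, hk⟩ l)
  have h1 : ∀ a, u (Function.update b l a)
      = ε • u (Function.update (b ∘ Equiv.swap ⟨0, hk⟩ l) ⟨0, hk⟩ a) := by
    intro a
    rw [← hε]
    congr 1
    rw [Function.update_comp_equiv, Function.comp_assoc, ← Equiv.coe_trans]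
    simp [Equiv.symm_swap]
  simp only [h1, map_zsmul, ← Finset.smul_sum, h0 hk, smul_zero]

end Fibre

/-! ### Covariant derivatives and the Ricci identity for a general fibre action -/

section Connection

variable {n : ℕ} {F : Type*} [NormedAddCommGroup F] [NormedSpace ℝ F] [FiniteDimensional ℝ F]
  {e : Frame n} {U : Set (Sph n)} {x : Sph n}

/-- The matrix of connection coefficients in the direction of a frame vector. -/
def connMat (e : Frame n) (a : Fin n) (x : Sph n) : Matrix (Fin n) (Fin n) ℝ :=
  Matrix.of fun i j => lcCoeff e a i j x

/-- Expanding over matrix units reduces derivatives of the variable operator `R (connMat e a y)` to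
those of its scalar coefficients. -/
lemma map_matrix_apply {E : Type*} [AddCommGroup E] [Module ℝ E]
    (R : Matrix (Fin n) (Fin n) ℝ →ₗ[ℝ] Module.End ℝ E) (M : Matrix (Fin n) (Fin n) ℝ) (u : E) :
    R M u = ∑ i, ∑ j, M i j • R (Matrix.single i j 1) u := by
  conv_lhs => rw [Matrix.matrix_eq_sum_single M]
  simp only [map_sum, LinearMap.sum_apply]
  refine Finset.sum_congr rfl fun i _ => Finset.sum_congr rfl fun j _ => ?_
  rw [← LinearMap.smul_apply, ← map_smul, Matrix.smul_single, smul_eq_mul, mul_one]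

lemma contMDiffAt_linear {V : Type*} [NormedAddCommGroup V] [NormedSpace ℝ V]
    (T : F →ₗ[ℝ] V) {f : Sph n → F} (hf : ContMDiffAt (𝓡 n) 𝓘(ℝ, F) ∞ f x) :
    ContMDiffAt (𝓡 n) 𝓘(ℝ, V) ∞ (fun y => T (f y)) x :=
  T.toContinuousLinearMap.contMDiff.contMDiffAt.comp x hf

lemma dirDeriv_linear {V : Type*} [NormedAddCommGroup V] [NormedSpace ℝ V]
    (T : F →ₗ[ℝ] V) {f : Sph n → F} (hf : ContMDiffAt (𝓡 n) 𝓘(ℝ, F) ∞ f x)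
    (v : TangentSpace (𝓡 n) x) :
    dirDeriv (fun y => T (f y)) x v = T (dirDeriv f x v) :=
  dirDeriv_clm T.toContinuousLinearMap hf v

/-- The covariant derivative along a frame vector, when matrices act on the fibre by `R`. -/
def frameDeriv (R : Matrix (Fin n) (Fin n) ℝ →ₗ[ℝ] Module.End ℝ F) (e : Frame n) (a : Fin n)
    (φ : Sph n → F) (x : Sph n) : F :=
  dirDeriv φ x (e a x) + R (connMat e a x) (φ x)

lemma IsOrthonormalFrame.contMDiffAt_connMat (he : IsOrthonormalFrame e U) (hU : IsOpen U)
    (hx : x ∈ U) (R : Matrix (Fin n) (Fin n) ℝ →ₗ[ℝ] Module.End ℝ F) {φ : Sph n → F}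
    (hφ : ContMDiffAt (𝓡 n) 𝓘(ℝ, F) ∞ φ x) (a : Fin n) :
    ContMDiffAt (𝓡 n) 𝓘(ℝ, F) ∞ (fun y => R (connMat e a y) (φ y)) x := by
  simp only [map_matrix_apply R (connMat e a _)]
  exact contMDiffAt_finsetSum fun i _ => contMDiffAt_finsetSum fun j _ =>
    ((he.contMDiffOn_lcCoeff hU a i j).contMDiffAt (hU.mem_nhds hx)).smul
      (contMDiffAt_linear _ hφ)

lemma IsOrthonormalFrame.dirDeriv_connMat (he : IsOrthonormalFrame e U) (hU : IsOpen U)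
    (hx : x ∈ U) (R : Matrix (Fin n) (Fin n) ℝ →ₗ[ℝ] Module.End ℝ F) {φ : Sph n → F}
    (hφ : ContMDiffAt (𝓡 n) 𝓘(ℝ, F) ∞ φ x) (a : Fin n) (v : TangentSpace (𝓡 n) x) :
    dirDeriv (fun y => R (connMat e a y) (φ y)) x v
      = R (Matrix.of fun i j => dirDeriv (lcCoeff e a i j) x v) (φ x)
        + R (connMat e a x) (dirDeriv φ x v) := by
  have hΓ := fun i j => (he.contMDiffOn_lcCoeff hU a i j).contMDiffAt (hU.mem_nhds hx)
  have hs : ∀ i j, ContMDiffAt (𝓡 n) 𝓘(ℝ, F) ∞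
      (fun y => lcCoeff e a i j y • R (Matrix.single i j 1) (φ y)) x := fun i j =>
    (hΓ i j).smul (contMDiffAt_linear _ hφ)
  rw [map_matrix_apply R (Matrix.of _), map_matrix_apply R (connMat e a x),
    show (fun y => R (connMat e a y) (φ y))
      = fun y => ∑ i, ∑ j, lcCoeff e a i j y • R (Matrix.single i j 1) (φ y) from
      funext fun y => map_matrix_apply R _ _]
  simp only [connMat, Matrix.of_apply]
  rw [dirDeriv_sum _ fun i => contMDiffAt_finsetSum fun j _ => hs i j]
  simp only [dirDeriv_sum _ (hs _), dirDeriv_smul (hΓ _ _) (contMDiffAt_linear _ hφ),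
    dirDeriv_linear _ hφ, Finset.sum_add_distrib]

lemma IsOrthonormalFrame.contMDiffOn_frameDeriv (he : IsOrthonormalFrame e U) (hU : IsOpen U)
    (R : Matrix (Fin n) (Fin n) ℝ →ₗ[ℝ] Module.End ℝ F) {φ : Sph n → F}
    (hφ : ContMDiffOn (𝓡 n) 𝓘(ℝ, F) ∞ φ U) (a : Fin n) :
    ContMDiffOn (𝓡 n) 𝓘(ℝ, F) ∞ (frameDeriv R e a φ) U := fun _ hy =>
  ((((he.contMDiffOn_dirDeriv hU hφ a).contMDiffAt (hU.mem_nhds hy)).add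
    (he.contMDiffAt_connMat hU hy R (hφ.contMDiffAt (hU.mem_nhds hy)) a))).contMDiffWithinAt

/-- The components `∇²_{a,c} φ` of the Hessian of a field. -/
def frameHessian (R : Matrix (Fin n) (Fin n) ℝ →ₗ[ℝ] Module.End ℝ F) (e : Frame n)
    (φ : Sph n → F) (x : Sph n) (a c : Fin n) : F :=
  frameDeriv R e a (frameDeriv R e c φ) x - ∑ d, lcCoeff e a c d x • frameDeriv R e d φ x

/-- The Ricci identity on the round sphere. -/
lemma IsOrthonormalFrame.frameHessian_sub (he : IsOrthonormalFrame e U) (hU : IsOpen U)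
    (hx : x ∈ U) (R : Matrix (Fin n) (Fin n) ℝ →ₗ[ℝ] Module.End ℝ F)
    (hR : ∀ M N : Matrix (Fin n) (Fin n) ℝ, (∀ i j, M i j = -M j i) →
      R M * R N - R N * R M = R (N * M - M * N))
    {φ : Sph n → F} (hφ : ContMDiffOn (𝓡 n) 𝓘(ℝ, F) ∞ φ U) (a c : Fin n) :
    frameHessian R e φ x a c - frameHessian R e φ x c a
      = R (Matrix.single c a 1 - Matrix.single a c 1) (φ x) := by
  have hφx := hφ.contMDiffAt (hU.mem_nhds hx)
  refine hessian_sub_hessian R (fun a => connMat e a x)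
    (fun a c => Matrix.of fun i j => dirDeriv (lcCoeff e c i j) x (e a x))
    (fun a c => hR _ _ fun i j => he.lcCoeff_antisymm hU hx a i j) (φ x)
    (fun a => dirDeriv φ x (e a x))
    (fun a c => dirDeriv (fun y => dirDeriv φ y (e c y)) x (e a x))
    (fun a c => he.dirDeriv_commutator hU hx hφ a c) ?_ _ ?_ a c
  · intro a c
    ext i j
    have h := he.dirDeriv_lcCoeff hU hx a c i j
    simp only [Matrix.sub_apply, Matrix.add_apply, Matrix.sum_apply, Matrix.smul_apply,
      Matrix.mul_apply, Matrix.of_apply, connMat, smul_eq_mul, Matrix.single_apply] at h ⊢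
    rw [h, ← Finset.sum_sub_distrib]
    congr 1
    · congr 1
      refine Finset.sum_congr rfl fun m _ => ?_
      -- The structure equation contracts the last indices of both coefficients; metric
      -- compatibility flips one in each term to form matrix products.
      rw [he.lcCoeff_antisymm hU hx a j m, he.lcCoeff_antisymm hU hx c j m]
      ring
    · simp only [ite_and, mul_ite, mul_one, mul_zero]
      split_ifs <;> rfl
  · intro a c
    have h1 : dirDeriv (frameDeriv R e c φ) x (e a x)
        = dirDeriv (fun y => dirDeriv φ y (e c y)) x (e a x)
          + (R (Matrix.of fun i j => dirDeriv (lcCoeff e c i j) x (e a x)) (φ x)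
            + R (connMat e c x) (dirDeriv φ x (e a x))) := by
      rw [← he.dirDeriv_connMat hU hx R hφx]
      exact dirDeriv_add ((he.contMDiffOn_dirDeriv hU hφ c).contMDiffAt (hU.mem_nhds hx))
        (he.contMDiffAt_connMat hU hx R hφx c) _
    rw [frameHessian, frameDeriv, h1]
    rfl

end Connection

/-! ### The Dirac operator and the connection Laplacian in a spin frame -/

section Spinors

variable {n : ℕ} {S : Type*} [NormedAddCommGroup S] [NormedSpace ℂ S]
  {e : Frame n} {U : Set (Sph n)} {x : Sph n} {k : ℕ}

lemma covDeriv_cons (ρ : Cl n →ₐ[ℝ] Module.End ℂ S) (φ : LocalField n S k) (a : Fin n)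
    (b : Fin k → Fin n) :
    covDeriv ρ e φ x (Fin.cons a b) = dirDeriv (fun y => φ y b) x (e a x)
      + (1 / 4 : ℝ) • ∑ i, ∑ j, lcCoeff e a i j x • gam ρ i (gam ρ j (φ x b))
      - ∑ l : Fin k, ∑ d, lcCoeff e a (b l) d x • φ x (Function.update b l d) := rfl

lemma covDeriv_eq_frameDeriv (ρ : Cl n →ₐ[ℝ] Module.End ℂ S) {φ : LocalField n S k}
    (hφ : ContMDiffAt (𝓡 n) 𝓘(ℝ, Fibre n S k) ∞ φ x) (a : Fin n) (b : Fin k → Fin n) :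
    covDeriv ρ e φ x (Fin.cons a b) = frameDeriv (fibreAct ρ k) e a φ x b := by
  have h := dirDeriv_clm (ContinuousLinearMap.proj (R := ℝ) (φ := fun _ => S) b) hφ (e a x)
  simp only [ContinuousLinearMap.proj_apply] at h
  simp only [covDeriv_cons, frameDeriv, Pi.add_apply,
    fibreAct_apply_apply, h, connMat, Matrix.of_apply]
  abel

lemma localDirac_eq (ρ : Cl n →ₐ[ℝ] Module.End ℂ S) {φ : LocalField n S k}
    (hφ : ContMDiffAt (𝓡 n) 𝓘(ℝ, Fibre n S k) ∞ φ x) :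
    localDirac ρ e φ x = ∑ a, gamOp ρ k a (frameDeriv (fibreAct ρ k) e a φ x) := by
  ext b
  simp only [localDirac, covDeriv_eq_frameDeriv ρ hφ, Finset.sum_apply, gamOp_apply]

variable [FiniteDimensional ℂ S]

lemma IsOrthonormalFrame.localDirac_localDirac (he : IsOrthonormalFrame e U) (hU : IsOpen U)
    (hx : x ∈ U) (ρ : Cl n →ₐ[ℝ] Module.End ℂ S) {φ : LocalField n S k}
    (hφ : ContMDiffOn (𝓡 n) 𝓘(ℝ, Fibre n S k) ∞ φ U) :
    localDirac ρ e (localDirac ρ e φ) x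
      = -∑ a, frameHessian (fibreAct ρ k) e φ x a a
        + (1 / 2 : ℝ) • ∑ a, ∑ c, gamOp ρ k a (gamOp ρ k c
          (frameHessian (fibreAct ρ k) e φ x a c - frameHessian (fibreAct ρ k) e φ x c a)) := by
  have : FiniteDimensional ℝ S := FiniteDimensional.complexToReal S
  have heq : localDirac ρ e φ =ᶠ[nhds x]
      fun y => ∑ c, gamOp ρ k c (frameDeriv (fibreAct ρ k) e c φ y) := by
    filter_upwards [hU.mem_nhds hx] with y hy
    exact localDirac_eq ρ (hφ.contMDiffAt (hU.mem_nhds hy))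
  have hψ : ∀ c, ContMDiffAt (𝓡 n) 𝓘(ℝ, Fibre n S k) ∞ (frameDeriv (fibreAct ρ k) e c φ) x :=
    fun c => (he.contMDiffOn_frameDeriv hU _ hφ c).contMDiffAt (hU.mem_nhds hx)
  have hG : ∀ c, ContMDiffAt (𝓡 n) 𝓘(ℝ, Fibre n S k) ∞
      (fun y => gamOp ρ k c (frameDeriv (fibreAct ρ k) e c φ y)) x :=
    fun c => contMDiffAt_linear _ (hψ c)
  have hD : ContMDiffAt (𝓡 n) 𝓘(ℝ, Fibre n S k) ∞ (localDirac ρ e φ) x :=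
    (contMDiffAt_finsetSum fun c _ => hG c).congr_of_eventuallyEq heq
  rw [← dirac_sq_eq (isCliffordSystem_gamOp ρ k) (fun a => connMat e a x)
    (fun a i j => he.lcCoeff_antisymm hU hx a i j)
    (fun c => frameDeriv (fibreAct ρ k) e c φ x)
    (fun a c => frameDeriv (fibreAct ρ k) e a (frameDeriv (fibreAct ρ k) e c φ) x)
    (frameHessian (fibreAct ρ k) e φ x) (fun a c => rfl), localDirac_eq ρ hD]
  refine Finset.sum_congr rfl fun a _ => congrArg _ ?_
  rw [frameDeriv, dirDeriv_congr heq, heq.eq_of_nhds, dirDeriv_sum _ hG, map_sum,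
    ← Finset.sum_add_distrib]
  refine Finset.sum_congr rfl fun c _ => ?_
  -- The extra term from commuting the connection with `γ_c` is the one that `dirac_sq_eq` absorbs.
  have h := congrArg (fun T : Module.End ℝ (Fibre n S k) => T (frameDeriv (fibreAct ρ k) e c φ x))
    (fibreAct_mul_gamOp ρ (k := k) (M := connMat e a x)
      (fun i j => he.lcCoeff_antisymm hU hx a i j) c)
  simp only [Module.End.mul_apply, LinearMap.add_apply, LinearMap.sum_apply,
    LinearMap.smul_apply] at h
  rw [h, dirDeriv_linear _ (hψ c), ← add_assoc, ← map_add]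
  rfl

lemma IsOrthonormalFrame.covDerivAdj_covDeriv (he : IsOrthonormalFrame e U) (hU : IsOpen U)
    (hx : x ∈ U) (ρ : Cl n →ₐ[ℝ] Module.End ℂ S) {φ : LocalField n S k}
    (hφ : ContMDiffOn (𝓡 n) 𝓘(ℝ, Fibre n S k) ∞ φ U) :
    covDerivAdj ρ e (covDeriv ρ e φ) x = -∑ a, frameHessian (fibreAct ρ k) e φ x a a := by
  have : FiniteDimensional ℝ S := FiniteDimensional.complexToReal S
  ext b
  simp only [covDerivAdj, Pi.neg_apply, Finset.sum_apply]
  refine congrArg _ (Finset.sum_congr rfl fun a _ => ?_)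
  have hψ : ContMDiffAt (𝓡 n) 𝓘(ℝ, Fibre n S k) ∞ (frameDeriv (fibreAct ρ k) e a φ) x :=
    (he.contMDiffOn_frameDeriv hU _ hφ a).contMDiffAt (hU.mem_nhds hx)
  have heq : (fun y => covDeriv ρ e φ y (Fin.cons a b)) =ᶠ[nhds x]
      fun y => frameDeriv (fibreAct ρ k) e a φ y b := by
    filter_upwards [hU.mem_nhds hx] with y hy
    exact covDeriv_eq_frameDeriv ρ (hφ.contMDiffAt (hU.mem_nhds hy)) a b
  have h := covDeriv_eq_frameDeriv (e := e) ρ hψ a b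
  have h2 := fun c b => covDeriv_eq_frameDeriv (e := e) ρ (hφ.contMDiffAt (hU.mem_nhds hx)) c b
  rw [frameHessian, Pi.sub_apply, ← h]
  rw [covDeriv_cons]
  -- Slot `0` of `∇φ` is the derivative index and supplies the connection correction in the Hessian;
  -- the remaining slots belong to the fibre of `φ`.
  simp only [Fin.cons_zero, dirDeriv_congr heq, Fin.sum_univ_succ, Fin.cons_succ,
    Fin.update_cons_zero, ← Fin.cons_update, h2, Finset.sum_apply, Pi.smul_apply]
  rw [covDeriv_cons]
  abel

end Spinors

end SphereSpin

end

/-! ### Assembly on each spin frame -/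

theorem mainTheorem3 (n k : ℕ) {S : Type*} [NormedAddCommGroup S] [NormedSpace ℂ S]
    [FiniteDimensional ℂ S] (hS : Module.finrank ℂ S = 2 ^ (n / 2))
    (ρ : SphereSpin.Cl n →ₐ[ℝ] Module.End ℂ S)
    {I : Type*} (σ : SphereSpin.SpinStructure n I)
    (Φ : SphereSpin.Field n I S k) (hΦ : SphereSpin.IsSmoothSection σ ρ Φ)
    (hform : SphereSpin.IsForm σ Φ ∨ SphereSpin.IsSymmetric σ Φ)
    (hγ : SphereSpin.CliffordAnnihilated σ ρ Φ) :
    ∀ i, ∀ x ∈ σ.dom i, ∀ b : Fin k → Fin n,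
      SphereSpin.dirac σ ρ (SphereSpin.dirac σ ρ Φ) i x b
        = SphereSpin.connLaplacian σ ρ Φ i x b
          + ((n : ℝ) * ((n : ℝ) - 1) / 4 + (k : ℝ)) • Φ i x b := by
  open SphereSpin in
  intro i x hx b
  have : FiniteDimensional ℝ S := FiniteDimensional.complexToReal S
  have hU := σ.isOpen_dom i
  have he := σ.isOrthonormalFrame i
  have hφ : ContMDiffOn (𝓡 n) 𝓘(ℝ, Fibre n S k) ∞ (Φ i) (σ.dom i) :=
    contMDiffOn_pi_space.2 fun b => hΦ.smooth i b
  have hπ : ∀ π : Equiv.Perm (Fin k), ∃ ε : ℤ, ∀ b, Φ i x (b ∘ π) = ε • Φ i x b := by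
    intro π
    rcases hform with h | h
    · exact ⟨_, h i x hx π⟩
    · exact ⟨1, fun b => by rw [h i x hx π b, one_smul]⟩
  have htr := sum_gam_update_eq_zero ρ hπ (hγ i x hx)
  have h1 := he.localDirac_localDirac hU hx ρ hφ
  simp only [he.frameHessian_sub hU hx (fibreAct ρ k)
    (fun M N hM => fibreAct_commutator ρ hM) hφ] at h1
  rw [curvature_term ρ (Φ i x) htr, ← he.covDerivAdj_covDeriv hU hx ρ hφ] at h1
  exact congrFun h1 b
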